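/- Let $d\ge 1$ and let $a,b,c$ be integers with $d\mid a+b+c$. Suppose that the linear map $\psi(z_1,z_2,z_3)=(\zeta^{a}z_1,\zeta^{b}z_2,\zeta^{c}z_3)$ of $\mathbb C^3$, where $\zeta=e^{2\pi i/d}$, has order exactly $d$ (equivalently, $\gcd(a,b,c,d)=1$), so that the cyclic group $\mu_d$ of order $d$ acts effectively on $\mathbb C^3$ with weights $(a,b,c)$. Let $\mathcal L\subset\mathbb R^3$ be the lattice spanned over $\mathbb Z$ by the standard unit vectors $e^1,e^2,e^3$ and the vector $(a/d,b/d,c/d)$. Let $\sigma=\{x\in\mathbb R^3 : x_1,x_2,x_3\ge 0\}$, and let $\mathcal F=\sigma\cap\{x_1+x_2+x_3=1\}$, which is a triangle. A smooth decomposition of $\mathcal F$ is a finite (geometric) simplicial complex in $\mathbb R^3$ whose underlying space is $\mathcal F$ and such that the three vertices of each of its two-simplices form a $\mathbb Z$-basis of $\mathcal L$. Put \[ d_1=\gcd(a,d),\quad d_2=\gcd(b,d),\quad d_3=\gcd(c,d).\] Then every smooth decomposition of $\mathcal F$ has exactly \[ v=\frac{d+2+(d_1+d_2+d_3)}{2}\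 \text{ vertices and }\ e=\frac{3d+(d_1+d_2+d_3)}{2}\ \text{ edges,}\] where the three corners of $\mathcal F$ are counted among the vertices. Here $d$ is arbitrary (not necessarily odd), and the $d_i$ need not be equal to $1$, i.e. the singular point of $\mathbb C^3/\mu_d$ need not be isolated. -/

import Mathlib

/-- The linear automorphism `ψ (z₁, z₂, z₃) = (ζ^a z₁, ζ^b z₂, ζ^c z₃)` of `ℂ³`, where
`ζ = exp (2πi / d)` and `w = (a, b, c)`. -/
noncomputable def quotientGenerator (d : ℕ) (w : Fin 3 → ℤ) : Module.End ℂ (Fin 3 → ℂ) :=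
  Matrix.toLin' (Matrix.diagonal fun i =>
    Complex.exp (2 * (Real.pi : ℂ) * Complex.I * ((w i : ℂ) / (d : ℂ))))

/-- The lattice in `ℝ³` spanned over `ℤ` by the standard unit vectors and by
`(a/d, b/d, c/d)`, where `w = (a, b, c)`. -/
def quotientLattice (d : ℕ) (w : Fin 3 → ℤ) : Submodule ℤ (Fin 3 → ℝ) :=
  Submodule.span ℤ
    (Set.range (fun i : Fin 3 => (Pi.single i 1 : Fin 3 → ℝ)) ∪
      {fun i : Fin 3 => (w i : ℝ) / (d : ℝ)})

/-- The positive octant of `ℝ³`. -/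
def octant : Set (Fin 3 → ℝ) := {x | ∀ i, 0 ≤ x i}

/-- The triangle cut out of the positive octant by the plane `x₁ + x₂ + x₃ = 1`. -/
def triangleFace : Set (Fin 3 → ℝ) := octant ∩ {x | ∑ i, x i = 1}

/-- A finite simplicial complex `K` is a smooth decomposition of the triangle if it subdivides
the triangle and the vertices of each of its two-simplices form a `ℤ`-basis of the lattice. -/
structure IsSmoothDecomposition (d : ℕ) (w : Fin 3 → ℤ)
    (K : Geometry.SimplicialComplex ℝ (Fin 3 → ℝ)) : Prop where
  finite : K.faces.Finite
  space_eq : K.space = triangleFace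
  isBasis : ∀ s ∈ K.faces, s.card = 3 →
    LinearIndependent ℤ ((↑) : s → (Fin 3 → ℝ)) ∧
      Submodule.span ℤ (s : Set (Fin 3 → ℝ)) = quotientLattice d w

/-! Write F for the triangle and L for the lattice. Unimodularity of the two-simplices makes every
lattice point of mF a natural combination, of total weight m, of the vertices of one simplex
(`exists_nat_combination`). For m = 1 this gives v = |F ∩ L|. For m = 2 each point is either twice a
vertex or the sum of the ends of a unique edge, so v + e = |2F ∩ L|. No Euler characteristic is
needed.

Both counts are arithmetic (`ncard_dilatedTrianglePoints`): the class of k modulo ℤ³ contributes the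
triples of naturals with sum m - age(k). Age is 1 or 2 for 0 < k < d, so the contribution is affine
in it, and only the sum of the ages matters. Pairing k with d - k evaluates that sum through the
gcds (`two_mul_sum_age`). -/

/-! ### Simplices in the triangle, and covering by two-simplices -/

theorem sum_eq_one_of_mem_face {K : Geometry.SimplicialComplex ℝ (Fin 3 → ℝ)}
    (hK : K.space = triangleFace) {s : Finset (Fin 3 → ℝ)} (hs : s ∈ K.faces)
    {x : Fin 3 → ℝ} (hx : x ∈ s) : ∑ i, x i = 1 := by
  have h := K.subset_space hs hx
  rw [hK] at h
  exact h.2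

/-- The vertices of a simplex in the plane `x₁ + x₂ + x₃ = 1` are linearly independent. -/
theorem linearIndependent_of_affineIndependent {s : Finset (Fin 3 → ℝ)}
    (hs : AffineIndependent ℝ ((↑) : s → (Fin 3 → ℝ))) (hsum : ∀ x ∈ s, ∑ i, x i = 1) :
    LinearIndependent ℝ ((↑) : s → (Fin 3 → ℝ)) := by
  rw [linearIndependent_iff']
  intro t g hg
  refine affineIndependent_iff.1 hs t g ?_ hg
  -- Adding up the coordinates of a linear relation shows that its coefficients sum to 0.
  have h : ∑ i, (∑ e ∈ t, g e • (e : Fin 3 → ℝ)) i = 0 := by rw [hg]; simp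
  simp only [Finset.sum_apply, Pi.smul_apply, smul_eq_mul] at h
  rw [Finset.sum_comm] at h
  rw [← h]
  refine Finset.sum_congr rfl fun e _ => ?_
  rw [← Finset.mul_sum, hsum e e.2, mul_one]

theorem linearIndependent_of_mem_faces {K : Geometry.SimplicialComplex ℝ (Fin 3 → ℝ)}
    (hK : K.space = triangleFace) {s : Finset (Fin 3 → ℝ)} (hs : s ∈ K.faces) :
    LinearIndependent ℝ ((↑) : s → (Fin 3 → ℝ)) :=
  linearIndependent_of_affineIndependent (K.indep hs) fun _ => sum_eq_one_of_mem_face hK hs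

theorem span_ne_top_of_mem_faces {K : Geometry.SimplicialComplex ℝ (Fin 3 → ℝ)}
    (hK : K.space = triangleFace) {s : Finset (Fin 3 → ℝ)} (hs : s ∈ K.faces)
    (hcard : s.card ≠ 3) : Submodule.span ℝ (s : Set (Fin 3 → ℝ)) ≠ ⊤ := by
  intro h
  have h1 := finrank_span_finset_eq_card (linearIndependent_of_mem_faces hK hs)
  rw [h, finrank_top] at h1
  simp at h1
  exact hcard h1.symm

/-- A finite triangulation of the triangle is covered by its two-simplices. -/
theorem exists_mem_convexHull_of_card_eq_three {K : Geometry.SimplicialComplex ℝ (Fin 3 → ℝ)}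
    (hfin : K.faces.Finite) (hK : K.space = triangleFace) {x : Fin 3 → ℝ}
    (hx : x ∈ triangleFace) :
    ∃ s ∈ K.faces, s.card = 3 ∧ x ∈ convexHull ℝ (s : Set (Fin 3 → ℝ)) := by
  -- A missed point yields a nonempty open cone `V` covered by the spans of the finitely many
  -- smaller faces. These are proper subspaces, hence null sets.
  by_contra! hcon
  set U : Set (Fin 3 → ℝ) :=
    ⋃ s ∈ {s ∈ K.faces | s.card = 3}, convexHull ℝ (s : Set (Fin 3 → ℝ)) with hU
  have hUc : IsClosed U := (hfin.subset (Set.sep_subset _ _)).isClosed_biUnion fun s _ =>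
    s.finite_toSet.isClosed_convexHull ℝ
  have hxU : x ∉ U := by
    simp only [hU, Set.mem_iUnion, not_exists]
    exact fun s hs => hcon s hs.1 hs.2
  -- Moving towards the barycentre makes all coordinates positive, and a small move stays off the
  -- closed set `U`.
  let γ : ℝ → Fin 3 → ℝ := fun t i => (1 - t) * x i + t * (1 / 3)
  have hγ : Continuous γ := by fun_prop
  have hγ0 : γ 0 = x := by ext i; simp [γ]
  have hev : ∀ᶠ t in nhdsWithin (0 : ℝ) (Set.Ioi 0), γ t ∉ U := by
    have hev0 : ∀ᶠ t in nhds (0 : ℝ), γ t ∈ Uᶜ :=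
      hγ.continuousAt.eventually_mem (hUc.isOpen_compl.mem_nhds (by simpa [hγ0] using hxU))
    exact hev0.filter_mono nhdsWithin_le_nhds
  obtain ⟨t, htU, ht0, ht1⟩ :=
    (hev.and (Ioo_mem_nhdsGT (zero_lt_one (α := ℝ)))).exists
  let V : Set (Fin 3 → ℝ) := {y | ∀ i, 0 < y i} ∩ {y | (∑ i, y i)⁻¹ • y ∈ U}ᶜ
  have hpos : ∀ y : Fin 3 → ℝ, (∀ i, 0 < y i) → 0 < ∑ i, y i := fun y hy =>
    Finset.sum_pos (fun i _ => hy i) Finset.univ_nonempty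
  have hP : IsOpen {y : Fin 3 → ℝ | ∀ i, 0 < y i} := by
    simp only [Set.ofPred_forall]
    exact isOpen_iInter_of_finite fun i => isOpen_lt continuous_const (continuous_apply i)
  have hVo : IsOpen V := by
    have hc : ContinuousOn (fun y : Fin 3 → ℝ => (∑ i, y i)⁻¹ • y) {y | ∀ i, 0 < y i} := by
      have hc' : ContinuousOn (fun y : Fin 3 → ℝ => ∑ i, y i) {y | ∀ i, 0 < y i} := by fun_prop
      exact (hc'.inv₀ fun y hy => (hpos y hy).ne').smul continuousOn_id
    exact hc.isOpen_inter_preimage hP hUc.isOpen_compl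
  have hγs : ∑ i, γ t i = 1 := by
    have h := hx.2
    simp only [Set.mem_ofPred_eq, Fin.sum_univ_three] at h
    simp only [γ, Fin.sum_univ_three]
    linear_combination (1 - t) * h
  have hVne : V.Nonempty := by
    refine ⟨γ t, fun i => ?_, ?_⟩
    · have := hx.1 i
      have : 0 ≤ (1 - t) * x i := mul_nonneg (by linarith) this
      simp only [γ]
      linarith
    · simpa [hγs] using htU
  have hVsub : V ⊆ ⋃ s ∈ {s ∈ K.faces | s.card ≠ 3},
      (Submodule.span ℝ (s : Set (Fin 3 → ℝ)) : Set (Fin 3 → ℝ)) := by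
    rintro y ⟨hy, hyU⟩
    have hs0 := hpos y hy
    have hyF : (∑ i, y i)⁻¹ • y ∈ K.space := by
      rw [hK]
      refine ⟨fun i => mul_nonneg (inv_nonneg.2 hs0.le) (hy i).le, ?_⟩
      simp only [Set.mem_ofPred_eq, Pi.smul_apply, smul_eq_mul, ← Finset.mul_sum]
      exact inv_mul_cancel₀ hs0.ne'
    obtain ⟨s, hs, hys⟩ := Geometry.SimplicialComplex.mem_space_iff.1 hyF
    have hcard : s.card ≠ 3 := fun h =>
      hyU (Set.mem_biUnion (show s ∈ {s ∈ K.faces | _} from ⟨hs, h⟩) hys)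
    refine Set.mem_biUnion (show s ∈ {s ∈ K.faces | s.card ≠ 3} from ⟨hs, hcard⟩) ?_
    have := convexHull_min Submodule.subset_span (Submodule.span ℝ (s : Set (Fin 3 → ℝ))).convex hys
    have h2 := Submodule.smul_mem _ (∑ i, y i) this
    rwa [smul_inv_smul₀ hs0.ne'] at h2
  have hnull : MeasureTheory.volume V = 0 := by
    refine MeasureTheory.measure_mono_null hVsub ?_
    refine (MeasureTheory.measure_biUnion_null_iff
      (hfin.subset (Set.sep_subset _ _)).countable).2 fun s hs => ?_
    exact MeasureTheory.Measure.addHaar_submodule _ _ (span_ne_top_of_mem_faces hK hs.1 hs.2)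
  exact (hVo.measure_pos MeasureTheory.volume hVne).ne' hnull

/-! ### Vertices and edges as lattice points -/

/-- The lattice points of the `m`-fold dilation of the triangle. -/
def dilatedTrianglePoints (d : ℕ) (w : Fin 3 → ℤ) (m : ℕ) : Set (Fin 3 → ℝ) :=
  {x | x ∈ quotientLattice d w ∧ (∀ i, 0 ≤ x i) ∧ ∑ i, x i = m}

namespace IsSmoothDecomposition

variable {d : ℕ} {w : Fin 3 → ℤ} {K : Geometry.SimplicialComplex ℝ (Fin 3 → ℝ)}

/-- Only two-simplices carry a lattice condition, so the covering result is used to place the vertex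
in one of them. -/
theorem vertex_mem (hK : IsSmoothDecomposition d w K) {x : Fin 3 → ℝ} (hx : x ∈ K.vertices) :
    x ∈ dilatedTrianglePoints d w 1 := by
  have hxF : x ∈ triangleFace := hK.space_eq ▸ K.vertices_subset_space hx
  obtain ⟨s, hs, hcard, hxs⟩ := exists_mem_convexHull_of_card_eq_three hK.finite hK.space_eq hxF
  rw [Geometry.SimplicialComplex.vertex_mem_convexHull_iff hx hs] at hxs
  refine ⟨?_, hxF.1, by simpa using hxF.2⟩
  rw [← (hK.isBasis s hs hcard).2]
  exact Submodule.subset_span hxs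

/-- A lattice point of a positive dilation of the triangle is a sum of vertices of a
two-simplex, with natural multiplicities. -/
theorem exists_nat_combination (hK : IsSmoothDecomposition d w K) {m : ℕ} (hm : 0 < m)
    {x : Fin 3 → ℝ} (hx : x ∈ dilatedTrianglePoints d w m) :
    ∃ s ∈ K.faces, ∃ n : (Fin 3 → ℝ) → ℕ,
      ∑ v ∈ s, n v = m ∧ ∑ v ∈ s, n v • v = x := by
  obtain ⟨hxL, hx0, hxs⟩ := hx
  have hm' : (0 : ℝ) < m := by exact_mod_cast hm
  have hyF : (m : ℝ)⁻¹ • x ∈ triangleFace := by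
    refine ⟨fun i => mul_nonneg (inv_nonneg.2 hm'.le) (hx0 i), ?_⟩
    simp only [Set.mem_ofPred_eq, Pi.smul_apply, smul_eq_mul, ← Finset.mul_sum, hxs]
    exact inv_mul_cancel₀ hm'.ne'
  obtain ⟨s, hs, hcard, hys⟩ := exists_mem_convexHull_of_card_eq_three hK.finite hK.space_eq hyF
  have hli := linearIndependent_of_mem_faces hK.space_eq hs
  rw [← (hK.isBasis s hs hcard).2, Submodule.mem_span_finset] at hxL
  obtain ⟨f, -, hf⟩ := hxL
  obtain ⟨g, hg0, hg1, hg⟩ := Finset.mem_convexHull'.1 hys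
  -- Real independence identifies the integral lattice coordinates with `m` times the barycentric
  -- ones, so they are nonnegative with sum `m`.
  have hfg : ∀ v ∈ s, (f v : ℝ) = m * g v := by
    have h : ∑ v ∈ s, ((f v : ℝ) - m * g v) • v = 0 := by
      simp only [sub_smul, mul_smul, Finset.sum_sub_distrib, ← Finset.smul_sum, hg,
        Int.cast_smul_eq_zsmul, hf]
      rw [smul_inv_smul₀ hm'.ne', sub_self]
    have h2 := linearIndependent_iff'.1 hli Finset.univ (fun v => (f v : ℝ) - m * g v)
      (by rw [Finset.sum_coe_sort s (fun v => ((f v : ℝ) - m * g v) • v)]; exact h)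
    intro v hv
    exact sub_eq_zero.1 (h2 ⟨v, hv⟩ (Finset.mem_univ _))
  have hf0 : ∀ v ∈ s, ((f v).toNat : ℤ) = f v := by
    intro v hv
    refine Int.toNat_of_nonneg ?_
    have : (0 : ℝ) ≤ f v := hfg v hv ▸ mul_nonneg hm'.le (hg0 v hv)
    exact_mod_cast this
  refine ⟨s, hs, fun v => (f v).toNat, ?_, ?_⟩
  · have : ((∑ v ∈ s, f v : ℤ) : ℝ) = m := by
      push_cast
      rw [Finset.sum_congr rfl hfg, ← Finset.mul_sum, hg1, mul_one]
    have h2 : ∑ v ∈ s, f v = m := by exact_mod_cast this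
    zify
    rw [← h2]
    exact Finset.sum_congr rfl hf0
  · rw [← hf]
    refine Finset.sum_congr rfl fun v hv => ?_
    rw [← natCast_zsmul, hf0 v hv]

/-- The vertices of a smooth decomposition are exactly the lattice points of the triangle. -/
theorem vertices_eq (hK : IsSmoothDecomposition d w K) :
    K.vertices = dilatedTrianglePoints d w 1 := by
  refine Set.Subset.antisymm (fun x hx => hK.vertex_mem hx) fun x hx => ?_
  obtain ⟨s, hs, n, hn, rfl⟩ := hK.exists_nat_combination one_pos hx
  obtain ⟨v, hv, hnv, hrest⟩ : ∃ v ∈ s, n v = 1 ∧ ∀ u ∈ s, u ≠ v → n u = 0 := by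
    obtain ⟨v, hv, hv0⟩ := Finset.exists_ne_zero_of_sum_ne_zero (hn.trans_ne one_ne_zero)
    have h1 := Finset.add_sum_erase s n hv
    have h2 : ∑ u ∈ s.erase v, n u = 0 := by omega
    exact ⟨v, hv, by omega, fun u hu huv =>
      Finset.sum_eq_zero_iff.1 h2 u (Finset.mem_erase.2 ⟨huv, hu⟩)⟩
  rw [Finset.sum_eq_single_of_mem v hv fun u hu huv => by simp [hrest u hu huv], hnv, one_smul]
  exact K.down_closed hs (Finset.singleton_subset_iff.2 hv) (Finset.singleton_nonempty v)

theorem midpoint_mem_convexHull (u v : Fin 3 → ℝ) :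
    (2 : ℝ)⁻¹ • (u + v) ∈ convexHull ℝ (({u, v} : Finset (Fin 3 → ℝ)) : Set (Fin 3 → ℝ)) := by
  rw [Finset.coe_pair, convexHull_pair]
  exact ⟨2⁻¹, 2⁻¹, by norm_num, by norm_num, by norm_num, by simp⟩

/-- Two faces meet in the hull of their common vertices. If an end of the edge were not common, the
midpoint would have to equal the other end. -/
theorem edge_subset_of_midpoint_mem {s : Finset (Fin 3 → ℝ)} (hs : s ∈ K.faces)
    {u v : Fin 3 → ℝ} (huv : u ≠ v) (he : {u, v} ∈ K.faces)
    (h : (2 : ℝ)⁻¹ • (u + v) ∈ convexHull ℝ (s : Set (Fin 3 → ℝ))) : u ∈ s ∧ v ∈ s := by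
  classical
  have hmem := K.inter_subset_convexHull he hs ⟨midpoint_mem_convexHull u v, h⟩
  have key : ∀ p q : Fin 3 → ℝ, p ≠ q →
      (2 : ℝ)⁻¹ • (p + q) ∈ convexHull ℝ ((({p, q} : Finset _) : Set (Fin 3 → ℝ)) ∩ s) → p ∈ s := by
    intro p q hpq hp
    by_contra hps
    have hsub : (({p, q} : Finset _) : Set (Fin 3 → ℝ)) ∩ s ⊆ {q} := by
      rintro y ⟨hy, hys⟩
      simp only [Finset.coe_insert, Finset.coe_singleton, Set.mem_insert_iff,
        Set.mem_singleton_iff] at hy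
      rcases hy with rfl | rfl
      · exact absurd hys hps
      · rfl
    have hq := convexHull_mono hsub hp
    rw [convexHull_singleton, Set.mem_singleton_iff] at hq
    apply hpq
    have h2 : p + q = (2 : ℝ) • q := (inv_smul_eq_iff₀ two_ne_zero).1 hq
    rw [two_smul] at h2
    exact add_right_cancel h2
  refine ⟨key u v huv hmem, key v u huv.symm ?_⟩
  rwa [Finset.pair_comm, add_comm]

/-- Sending an edge to the sum of its end points identifies the edges with the lattice points of
the doubled triangle that are not the double of a lattice point of the triangle. -/
theorem bijOn_edges (hK : IsSmoothDecomposition d w K) :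
    Set.BijOn (fun s : Finset (Fin 3 → ℝ) => ∑ v ∈ s, v) {s ∈ K.faces | s.card = 2}
      (dilatedTrianglePoints d w 2 \ (fun x => (2 : ℕ) • x) '' dilatedTrianglePoints d w 1) := by
  classical
  refine ⟨?_, ?_, ?_⟩
  · rintro s ⟨hs, hcard⟩
    obtain ⟨u, v, huv, rfl⟩ := Finset.card_eq_two.1 hcard
    have hu := hK.vertex_mem (K.down_closed hs (t := {u}) (by simp) (by simp))
    have hv := hK.vertex_mem (K.down_closed hs (t := {v}) (by simp) (by simp))
    simp only [Finset.sum_pair huv]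
    refine ⟨⟨add_mem hu.1 hv.1, fun i => add_nonneg (hu.2.1 i) (hv.2.1 i), ?_⟩, ?_⟩
    · simp only [Pi.add_apply, Finset.sum_add_distrib, hu.2.2, hv.2.2]
      norm_num
    · rintro ⟨x, hx, hxuv⟩
      rw [← hK.vertices_eq] at hx
      have h2 : (2 : ℝ)⁻¹ • (u + v) = x := by
        rw [← hxuv]
        simp only [two_smul ℕ, ← two_smul ℝ]
        rw [inv_smul_smul₀ two_ne_zero]
      have := edge_subset_of_midpoint_mem (s := {x}) hx huv hs (by simp [h2])
      simp only [Finset.mem_singleton] at this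
      exact huv (this.1.trans this.2.symm)
  · rintro s ⟨hs, hcs⟩ t ⟨ht, hct⟩ hst
    obtain ⟨u, v, huv, rfl⟩ := Finset.card_eq_two.1 hcs
    obtain ⟨p, q, hpq, rfl⟩ := Finset.card_eq_two.1 hct
    simp only [Finset.sum_pair huv, Finset.sum_pair hpq] at hst
    have := edge_subset_of_midpoint_mem ht huv hs (hst ▸ midpoint_mem_convexHull p q)
    exact Finset.eq_of_subset_of_card_le
      (Finset.insert_subset this.1 (Finset.singleton_subset_iff.2 this.2)) (by rw [hcs, hct])
  · rintro x ⟨hx, hx2⟩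
    obtain ⟨s, hs, n, hn, rfl⟩ := hK.exists_nat_combination two_pos hx
    -- A multiplicity of 2 would use up the total weight and make the point twice a vertex.
    have hne : ∀ v ∈ s, n v ≤ 1 := by
      intro v hv
      by_contra! hlt
      have h1 := Finset.add_sum_erase s n hv
      have h2 : n v = 2 := by omega
      have h3 : ∑ u ∈ s.erase v, n u = 0 := by omega
      apply hx2
      refine ⟨v, hK.vertex_mem (K.down_closed hs (t := {v}) (by simpa) (by simp)), ?_⟩
      rw [← Finset.add_sum_erase s _ hv, h2, Finset.sum_eq_zero (s := s.erase v), add_zero]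
      intro u hu
      rw [Finset.sum_eq_zero_iff.1 h3 u hu, zero_smul]
    have hcard : (s.filter fun v => n v ≠ 0).card = 2 := by
      rw [Finset.card_filter, ← hn]
      refine Finset.sum_congr rfl fun v hv => ?_
      have := hne v hv
      split_ifs <;> omega
    refine ⟨s.filter fun v => n v ≠ 0, ⟨K.down_closed hs (Finset.filter_subset _ _) ?_, hcard⟩, ?_⟩
    · exact Finset.card_pos.1 (by omega)
    · simp only [Finset.sum_filter]
      refine Finset.sum_congr rfl fun v hv => ?_
      have := hne v hv
      split_ifs with h
      · rw [show n v = 1 by omega, one_smul]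
      · rw [show n v = 0 by omega, zero_smul]

end IsSmoothDecomposition

/-! ### Faithfulness of the action and lattice coordinates -/

theorem quotientGenerator_pow_eq_one_iff {d : ℕ} (hd : 0 < d) (w : Fin 3 → ℤ) (k : ℕ) :
    quotientGenerator d w ^ k = 1 ↔ ∀ i, (d : ℤ) ∣ k * w i := by
  have hpi : (2 * (Real.pi : ℂ) * Complex.I) ≠ 0 := Complex.two_pi_I_ne_zero
  have hdC : (d : ℂ) ≠ 0 := by exact_mod_cast hd.ne'
  rw [quotientGenerator, ← Matrix.toLin'_pow, Module.End.one_eq_id, ← Matrix.toLin'_one,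
    Matrix.toLin'.injective.eq_iff, Matrix.diagonal_pow, ← Matrix.diagonal_one,
    Matrix.diagonal_eq_diagonal_iff]
  refine forall_congr' fun i => ?_
  rw [Pi.pow_apply, ← Complex.exp_nat_mul, Complex.exp_eq_one_iff]
  refine exists_congr fun n => ?_
  have : (k : ℂ) * (2 * (Real.pi : ℂ) * Complex.I * ((w i : ℂ) / (d : ℂ))) =
      n * (2 * (Real.pi : ℂ) * Complex.I) ↔ (k : ℂ) * w i = d * n := by
    rw [show (k : ℂ) * (2 * (Real.pi : ℂ) * Complex.I * ((w i : ℂ) / (d : ℂ))) =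
      ((k : ℂ) * w i / d) * (2 * (Real.pi : ℂ) * Complex.I) by ring, mul_left_inj' hpi,
      div_eq_iff hdC, mul_comm (n : ℂ)]
  rw [this]
  exact_mod_cast Iff.rfl

theorem dvd_of_orderOf_quotientGenerator {d : ℕ} (hd : 0 < d) {w : Fin 3 → ℤ}
    (h : orderOf (quotientGenerator d w) = d) (k : ℤ) (hk : ∀ i, (d : ℤ) ∣ k * w i) :
    (d : ℤ) ∣ k := by
  have hk' : ∀ i, (d : ℤ) ∣ (k.natAbs : ℤ) * w i := by
    intro i
    rcases Int.natAbs_eq k with h | h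
    · rw [← h]; exact hk i
    · have := hk i
      rw [h, neg_mul] at this
      exact (dvd_neg).1 this
  have := orderOf_dvd_of_pow_eq_one ((quotientGenerator_pow_eq_one_iff hd w k.natAbs).2 hk')
  rw [h] at this
  exact Int.natCast_dvd.2 this

theorem mem_quotientLattice_iff {d : ℕ} {w : Fin 3 → ℤ} {x : Fin 3 → ℝ} :
    x ∈ quotientLattice d w ↔
      ∃ (z : Fin 3 → ℤ) (k : ℤ), ∀ i, x i = z i + k * (w i / d) := by
  rw [quotientLattice, Submodule.span_union, Submodule.mem_sup]
  simp only [Submodule.mem_span_range_iff_exists_fun, Submodule.mem_span_singleton]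
  constructor
  · rintro ⟨_, ⟨z, rfl⟩, _, ⟨k, rfl⟩, rfl⟩
    refine ⟨z, k, fun i => ?_⟩
    simp [Finset.sum_apply, Pi.single_apply]
  · rintro ⟨z, k, h⟩
    refine ⟨_, ⟨z, rfl⟩, _, ⟨k, rfl⟩, ?_⟩
    ext i
    simp [Finset.sum_apply, Pi.single_apply, h]

/-! ### Ages and their sum -/

/-- The age of the `k`-th power of the generator: the sum of the fractional parts of
`k w i / d`. -/
def age (d : ℕ) (w : Fin 3 → ℤ) (k : ℕ) : ℤ := (∑ i, k * w i % d) / d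

/-- The integer division in `age` is exact, because the residues sum to `k * ∑ i, w i` modulo `d`.
-/
theorem mul_age {d : ℕ} {w : Fin 3 → ℤ} (hsum : (d : ℤ) ∣ ∑ i, w i) (k : ℕ) :
    d * age d w k = ∑ i, k * w i % d := by
  refine Int.mul_ediv_cancel' ?_
  have h : ∑ i, (k * w i % d) = k * ∑ i, w i - d * ∑ i, (k * w i / d) := by
    simp only [Finset.mul_sum, ← Finset.sum_sub_distrib, Int.emod_def]
  rw [h]
  exact dvd_sub (hsum.mul_left _) (dvd_mul_right _ _)

theorem age_zero (d : ℕ) (w : Fin 3 → ℤ) : age d w 0 = 0 := by simp [age]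

/-- Age 0 would force all residues to vanish, against faithfulness. -/
theorem one_le_age {d : ℕ} {w : Fin 3 → ℤ} (hd : 0 < d) (hsum : (d : ℤ) ∣ ∑ i, w i)
    (hfaith : ∀ k : ℤ, (∀ i, (d : ℤ) ∣ k * w i) → (d : ℤ) ∣ k) {k : ℕ} (hk0 : 0 < k)
    (hkd : k < d) : 1 ≤ age d w k := by
  have hd' : (0 : ℤ) < d := by exact_mod_cast hd
  have hr : ∀ i ∈ Finset.univ, 0 ≤ (k : ℤ) * w i % d := fun i _ => Int.emod_nonneg _ hd'.ne'
  by_contra! hlt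
  have h0 : ∑ i, (k : ℤ) * w i % d = 0 := by
    refine le_antisymm ?_ (Finset.sum_nonneg hr)
    rw [← mul_age hsum]
    exact mul_nonpos_of_nonneg_of_nonpos hd'.le (by omega)
  rw [Finset.sum_eq_zero_iff_of_nonneg hr] at h0
  have := hfaith k fun i => Int.dvd_of_emod_eq_zero (h0 i (Finset.mem_univ i))
  have := Nat.le_of_dvd hk0 (Int.natCast_dvd_natCast.1 this)
  omega

theorem age_le_two {d : ℕ} {w : Fin 3 → ℤ} (hd : 0 < d) (hsum : (d : ℤ) ∣ ∑ i, w i) (k : ℕ) :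
    age d w k ≤ 2 := by
  have hd' : (0 : ℤ) < d := by exact_mod_cast hd
  have hr := fun i => Int.emod_lt_of_pos ((k : ℤ) * w i) hd'
  have h := mul_age hsum k
  rw [Fin.sum_univ_three] at h
  have : (d : ℤ) * age d w k < d * 3 := by linarith [hr 0, hr 1, hr 2]
  have := lt_of_mul_lt_mul_left this hd'.le
  omega

/-- With `g` the gcd and `d = g * e`, the condition becomes `e ∣ k`, which has `g` solutions below
`d`. -/
theorem card_filter_dvd_mul {d : ℕ} (hd : 0 < d) (a : ℤ) :
    ((Finset.range d).filter fun k : ℕ => (d : ℤ) ∣ k * a).card = Int.gcd a d := by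
  set g := Int.gcd a d with hg
  have hgpos : 0 < g := Int.gcd_pos_of_ne_zero_right _ (by exact_mod_cast hd.ne')
  obtain ⟨e, he⟩ : g ∣ d := by exact_mod_cast (Int.gcd_dvd_right a d)
  have hepos : 0 < e := Nat.pos_of_ne_zero fun h => by simp [h] at he; omega
  have hiff : ∀ k : ℕ, (d : ℤ) ∣ k * a ↔ e ∣ k := by
    intro k
    rw [Int.natCast_dvd, Int.natAbs_mul, Int.natAbs_natCast]
    have hg' : g = Nat.gcd a.natAbs d := by simp [hg, Int.gcd]
    obtain ⟨a', ha'⟩ : g ∣ a.natAbs := hg' ▸ Nat.gcd_dvd_left _ _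
    have hcop : Nat.Coprime a' e := by
      have h1 : g * Nat.gcd a' e = g * 1 := by
        rw [← Nat.gcd_mul_left, ← ha', ← he, mul_one, hg']
      exact Nat.eq_of_mul_eq_mul_left hgpos h1
    rw [ha', he, mul_left_comm, Nat.mul_dvd_mul_iff_left hgpos]
    exact hcop.symm.dvd_mul_right
  have : ((Finset.range d).filter fun k : ℕ => (d : ℤ) ∣ k * a) =
      (Finset.range g).image (fun j => e * j) := by
    ext k
    simp only [Finset.mem_filter, Finset.mem_range, Finset.mem_image, hiff]
    constructor
    · rintro ⟨hk, j, rfl⟩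
      refine ⟨j, ?_, rfl⟩
      rw [he, mul_comm] at hk
      exact lt_of_mul_lt_mul_right hk (Nat.zero_le e)
    · rintro ⟨j, hj, rfl⟩
      refine ⟨?_, dvd_mul_right _ _⟩
      rw [he, mul_comm]
      exact Nat.mul_lt_mul_of_pos_right hj hepos
  rw [this, Finset.card_image_of_injective _ (fun i j h => Nat.eq_of_mul_eq_mul_left hepos h),
    Finset.card_range]

theorem emod_add_neg_emod {d : ℕ} (hd : 0 < d) (x : ℤ) :
    x % d + (-x) % d = d - if (d : ℤ) ∣ x then (d : ℤ) else 0 := by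
  have hd' : (0 : ℤ) < d := by exact_mod_cast hd
  split_ifs with h
  · rw [Int.emod_eq_zero_of_dvd h, Int.emod_eq_zero_of_dvd (dvd_neg.2 h)]
    ring
  · rw [Int.neg_emod, if_neg h, Int.natAbs_natCast]
    ring

/-- The residues of `x` and `-x` add up to `d`, or to 0 when `d ∣ x`. -/
theorem age_add_age_sub {d : ℕ} {w : Fin 3 → ℤ} (hd : 0 < d) (hsum : (d : ℤ) ∣ ∑ i, w i)
    {k : ℕ} (hk : k ≤ d) :
    age d w k + age d w (d - k) = 3 - ∑ i, if (d : ℤ) ∣ k * w i then 1 else 0 := by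
  have hd' : (0 : ℤ) < d := by exact_mod_cast hd
  apply mul_left_cancel₀ hd'.ne'
  rw [mul_add, mul_age hsum, mul_age hsum, ← Finset.sum_add_distrib]
  have : ∀ i, (k : ℤ) * w i % d + ((d - k : ℕ) : ℤ) * w i % d =
      d - d * if (d : ℤ) ∣ k * w i then 1 else 0 := by
    intro i
    have h1 : ((d - k : ℕ) : ℤ) * w i % d = (-(k * w i)) % d := by
      rw [Nat.cast_sub hk, show ((d : ℤ) - k) * w i = -(k * w i) + d * w i by ring,
        Int.add_mul_emod_self_left]
    rw [h1, emod_add_neg_emod hd]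
    split_ifs <;> ring
  rw [Finset.sum_congr rfl fun i _ => this i, Finset.sum_sub_distrib, ← Finset.mul_sum]
  simp
  ring

/-- The sum of all ages, evaluated by pairing `k` with `d - k`. -/
theorem two_mul_sum_age {d : ℕ} {w : Fin 3 → ℤ} (hd : 0 < d) (hsum : (d : ℤ) ∣ ∑ i, w i) :
    2 * ∑ k ∈ Finset.Ico 1 d, age d w k = 3 * d - ∑ i, (Int.gcd (w i) d : ℤ) := by
  have hrefl : ∑ k ∈ Finset.Ico 1 d, age d w (d - k) = ∑ k ∈ Finset.Ico 1 d, age d w k := by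
    refine Finset.sum_nbij' (fun k => d - k) (fun k => d - k) ?_ ?_ ?_ ?_ fun _ _ => rfl
    all_goals
      intro k hk
      simp only [Finset.mem_Ico] at hk ⊢
      omega
  have hcount : ∀ i, ∑ k ∈ Finset.Ico 1 d, (if (d : ℤ) ∣ k * w i then (1 : ℤ) else 0) =
      Int.gcd (w i) d - 1 := by
    intro i
    -- The gcd also counts `k = 0`, hence the `- 1`.
    rw [← card_filter_dvd_mul hd, Finset.card_filter, Finset.range_eq_Ico,
      Finset.sum_eq_sum_Ico_succ_bot hd]
    push_cast
    simp
  have h : ∑ k ∈ Finset.Ico 1 d, (age d w k + age d w (d - k)) =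
      ∑ k ∈ Finset.Ico 1 d, (3 - ∑ i, if (d : ℤ) ∣ k * w i then (1 : ℤ) else 0) :=
    Finset.sum_congr rfl fun k hk => age_add_age_sub hd hsum (Finset.mem_Ico.1 hk).2.le
  rw [Finset.sum_add_distrib, hrefl, Finset.sum_sub_distrib, Finset.sum_comm,
    Finset.sum_congr rfl fun i _ => hcount i, Finset.sum_sub_distrib] at h
  simp only [Finset.sum_const, Nat.card_Ico, Finset.card_univ, Fintype.card_fin, nsmul_eq_mul,
    Nat.cast_sub (show 1 ≤ d from hd)] at h
  push_cast at h
  linarith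

/-! ### Counting lattice points of the dilated triangles -/

/-- The triples of natural numbers that complete age `s` to `m`. -/
def complements (m : ℕ) (s : ℤ) : Finset (Fin 3 → ℕ) :=
  if s ≤ m then Finset.Nat.antidiagonalTuple 3 (m - s).toNat else ∅

theorem mem_complements {m : ℕ} {s : ℤ} {n : Fin 3 → ℕ} :
    n ∈ complements m s ↔ ∑ i, (n i : ℤ) + s = m := by
  have h : ∑ i, (n i : ℤ) = ((∑ i, n i : ℕ) : ℤ) := by push_cast; rfl
  rw [complements, h]
  split_ifs with hs
  · rw [Finset.Nat.mem_antidiagonalTuple]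
    omega
  · simp only [Finset.notMem_empty, false_iff]
    omega

/-- The lattice points of the dilated triangle, sorted by their class modulo `ℤ³`. -/
theorem ncard_dilatedTrianglePoints {d : ℕ} {w : Fin 3 → ℤ} (hd : 0 < d)
    (hsum : (d : ℤ) ∣ ∑ i, w i)
    (hfaith : ∀ k : ℤ, (∀ i, (d : ℤ) ∣ k * w i) → (d : ℤ) ∣ k) (m : ℕ) :
    (dilatedTrianglePoints d w m).Finite ∧ (dilatedTrianglePoints d w m).ncard =
      ∑ k ∈ Finset.range d, (complements m (age d w k)).card := by
  classical
  have hd' : (0 : ℤ) < d := by exact_mod_cast hd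
  have hdR : (0 : ℝ) < d := by exact_mod_cast hd
  -- The integer part plus the fractional part of `k * w i / d`.
  let f : (_ : ℕ) × (Fin 3 → ℕ) → Fin 3 → ℝ :=
    fun p i => p.2 i + ((p.1 * w i % d : ℤ) : ℝ) / d
  let S := (Finset.range d).sigma fun k => complements m (age d w k)
  have hf : ∀ (p : (_ : ℕ) × (Fin 3 → ℕ)) i,
      d * f p i = ((d * p.2 i + p.1 * w i % d : ℤ) : ℝ) := by
    intro p i
    simp only [f]
    push_cast
    field_simp
  have hsumf : ∀ p : (_ : ℕ) × (Fin 3 → ℕ),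
      ∑ i, f p i = ((∑ i, (p.2 i : ℤ) + age d w p.1 : ℤ) : ℝ) := by
    intro p
    apply mul_left_cancel₀ hdR.ne'
    rw [Finset.mul_sum, Finset.sum_congr rfl fun i _ => hf p i]
    have h : ∑ i, (d * p.2 i + p.1 * w i % d : ℤ) = d * (∑ i, (p.2 i : ℤ) + age d w p.1) := by
      rw [mul_add, mul_age hsum, Finset.sum_add_distrib, Finset.mul_sum]
    exact_mod_cast h
  have himage : dilatedTrianglePoints d w m = (S.image f : Finset (Fin 3 → ℝ)) := by
    ext x
    simp only [Finset.coe_image, Set.mem_image, Finset.mem_coe, S, Finset.mem_sigma,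
      Finset.mem_range, mem_complements]
    constructor
    · rintro ⟨hxL, hx0, hxs⟩
      obtain ⟨z, k, hzk⟩ := mem_quotientLattice_iff.1 hxL
      obtain ⟨l, hl⟩ : ∃ l : ℕ, (l : ℤ) = k % d :=
        ⟨(k % d).toNat, Int.toNat_of_nonneg (Int.emod_nonneg _ hd'.ne')⟩
      have hld : l < d := by
        have := Int.emod_lt_of_pos k hd'
        omega
      let q : Fin 3 → ℤ := fun i => z i + k * w i / d
      have hlk : ∀ i, (l * w i % d : ℤ) = k * w i % d := fun i =>
        hl ▸ (Int.mod_modEq k d).mul_right (w i)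
      have hq : ∀ i, x i = q i + ((l * w i % d : ℤ) : ℝ) / d := by
        intro i
        have h1 : ((d * (k * w i / d) + k * w i % d : ℤ) : ℝ) = ((k * w i : ℤ) : ℝ) := by
          rw [Int.mul_ediv_add_emod]
        rw [hzk, hlk]
        simp only [q]
        push_cast at h1 ⊢
        field_simp
        linear_combination -h1
      -- The fractional part is below 1 and `x i ≥ 0`, so the integer `q i` exceeds -1.
      have hq0 : ∀ i, 0 ≤ q i := by
        intro i
        have h1 : ((l * w i % d : ℤ) : ℝ) / d < 1 := by
          rw [div_lt_one hdR]
          exact_mod_cast Int.emod_lt_of_pos (l * w i) hd'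
        have h2 : (-1 : ℝ) < q i := by linarith [hx0 i, hq i]
        have : (-1 : ℤ) < q i := by exact_mod_cast h2
        omega
      have hfx : f ⟨l, fun i => (q i).toNat⟩ = x := by
        ext i
        have : (((q i).toNat : ℤ) : ℝ) = q i := by rw [Int.toNat_of_nonneg (hq0 i)]
        simp only [f, hq i, ← this, Int.cast_natCast]
      refine ⟨⟨l, fun i => (q i).toNat⟩, ⟨hld, ?_⟩, hfx⟩
      have h := hsumf ⟨l, fun i => (q i).toNat⟩
      rw [hfx, hxs] at h
      exact_mod_cast h.symm
    · rintro ⟨⟨k, n⟩, ⟨hk, hn⟩, rfl⟩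
      refine ⟨?_, fun i => ?_, ?_⟩
      · refine mem_quotientLattice_iff.2 ⟨fun i => n i - k * w i / d, k, fun i => ?_⟩
        have h1 : ((d * (k * w i / d) + k * w i % d : ℤ) : ℝ) = ((k * w i : ℤ) : ℝ) := by
          rw [Int.mul_ediv_add_emod]
        simp only [f]
        push_cast at h1 ⊢
        field_simp
        linear_combination h1
      · have : 0 ≤ (k * w i % d : ℤ) := Int.emod_nonneg _ hd'.ne'
        have : (0 : ℝ) ≤ ((k * w i % d : ℤ) : ℝ) := by exact_mod_cast this
        simp only [f]
        positivity
      · rw [hsumf, hn]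
        simp
  have hinj : Set.InjOn f S := by
    rintro ⟨k, n⟩ hk ⟨l, n'⟩ hl h
    simp only [S, Finset.mem_coe, Finset.mem_sigma, Finset.mem_range] at hk hl
    have hi : ∀ i, (d * n i + k * w i % d : ℤ) = d * n' i + l * w i % d := by
      intro i
      have := (hf ⟨k, n⟩ i).symm.trans ((congrArg (fun y => (d : ℝ) * y i) h).trans (hf ⟨l, n'⟩ i))
      exact_mod_cast this
    have hmod : ∀ i, (k * w i % d : ℤ) = l * w i % d := by
      intro i
      have := congrArg (· % (d : ℤ)) (hi i)
      simpa using this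
    -- Equal residues make `l - k` act trivially; faithfulness separates the classes.
    have hdvd : (d : ℤ) ∣ (l : ℤ) - k := by
      refine hfaith _ fun i => ?_
      rw [sub_mul]
      exact Int.ModEq.dvd (hmod i)
    have hkl : k = l := by
      have : k ≡ l [MOD d] := (Nat.modEq_iff_dvd).2 hdvd
      exact this.eq_of_lt_of_lt hk.1 hl.1
    subst hkl
    have hnn : n = n' := by
      ext i
      have := hi i
      have := mul_left_cancel₀ hd'.ne' (add_right_cancel this)
      exact_mod_cast this
    rw [hnn]
  rw [himage]
  refine ⟨Finset.finite_toSet _, ?_⟩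
  rw [Set.ncard_coe_finset, Finset.card_image_of_injOn hinj, Finset.card_sigma]

/-- Only two ages occur, so the count can be written as an affine function of the age and summed. -/
theorem card_complements_one {s : ℤ} (h1 : 1 ≤ s) (h2 : s ≤ 2) :
    ((complements 1 s).card : ℤ) = 2 - s := by
  obtain rfl | rfl : s = 1 ∨ s = 2 := by omega
  all_goals decide

theorem card_complements_two {s : ℤ} (h1 : 1 ≤ s) (h2 : s ≤ 2) :
    ((complements 2 s).card : ℤ) = 5 - 2 * s := by
  obtain rfl | rfl : s = 1 ∨ s = 2 := by omega
  all_goals decide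

theorem card_complements_one_zero : (complements 1 0).card = 3 := by decide

theorem card_complements_two_zero : (complements 2 0).card = 6 := by decide

theorem two_mul_ncard_dilatedTrianglePoints_one {d : ℕ} {w : Fin 3 → ℤ} (hd : 0 < d)
    (hsum : (d : ℤ) ∣ ∑ i, w i)
    (hfaith : ∀ k : ℤ, (∀ i, (d : ℤ) ∣ k * w i) → (d : ℤ) ∣ k) :
    (2 * (dilatedTrianglePoints d w 1).ncard : ℤ) = d + 2 + ∑ i, (Int.gcd (w i) d : ℤ) := by
  rw [(ncard_dilatedTrianglePoints hd hsum hfaith 1).2, Finset.range_eq_Ico,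
    Finset.sum_eq_sum_Ico_succ_bot hd, age_zero, card_complements_one_zero, zero_add]
  have h : ∀ k ∈ Finset.Ico 1 d, ((complements 1 (age d w k)).card : ℤ) = 2 - age d w k := by
    intro k hk
    rw [Finset.mem_Ico] at hk
    exact card_complements_one (one_le_age hd hsum hfaith hk.1 hk.2) (age_le_two hd hsum k)
  push_cast
  rw [Finset.sum_congr rfl h, Finset.sum_sub_distrib]
  simp only [Finset.sum_const, Nat.card_Ico, nsmul_eq_mul, Nat.cast_sub (show 1 ≤ d from hd)]
  have := two_mul_sum_age hd hsum
  push_cast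
  linarith

theorem ncard_dilatedTrianglePoints_two {d : ℕ} {w : Fin 3 → ℤ} (hd : 0 < d)
    (hsum : (d : ℤ) ∣ ∑ i, w i)
    (hfaith : ∀ k : ℤ, (∀ i, (d : ℤ) ∣ k * w i) → (d : ℤ) ∣ k) :
    ((dilatedTrianglePoints d w 2).ncard : ℤ) = 2 * d + 1 + ∑ i, (Int.gcd (w i) d : ℤ) := by
  rw [(ncard_dilatedTrianglePoints hd hsum hfaith 2).2, Finset.range_eq_Ico,
    Finset.sum_eq_sum_Ico_succ_bot hd, age_zero, card_complements_two_zero, zero_add]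
  have h : ∀ k ∈ Finset.Ico 1 d, ((complements 2 (age d w k)).card : ℤ) = 5 - 2 * age d w k := by
    intro k hk
    rw [Finset.mem_Ico] at hk
    exact card_complements_two (one_le_age hd hsum hfaith hk.1 hk.2) (age_le_two hd hsum k)
  push_cast
  rw [Finset.sum_congr rfl h, Finset.sum_sub_distrib, ← Finset.mul_sum]
  simp only [Finset.sum_const, Nat.card_Ico, nsmul_eq_mul, Nat.cast_sub (show 1 ≤ d from hd)]
  have := two_mul_sum_age hd hsum
  push_cast
  linarith

/-! ### Assembling the vertex and edge counts -/

theorem IsSmoothDecomposition.ncard_edges_add_ncard_vertices {d : ℕ} {w : Fin 3 → ℤ}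
    {K : Geometry.SimplicialComplex ℝ (Fin 3 → ℝ)} (hK : IsSmoothDecomposition d w K)
    (hfin : (dilatedTrianglePoints d w 2).Finite) :
    {s ∈ K.faces | s.card = 2}.ncard + K.vertices.ncard =
      (dilatedTrianglePoints d w 2).ncard := by
  have hinj : Function.Injective (fun x : Fin 3 → ℝ => (2 : ℕ) • x) :=
    nsmul_right_injective two_ne_zero
  have hsub : (fun x : Fin 3 → ℝ => (2 : ℕ) • x) '' dilatedTrianglePoints d w 1 ⊆
      dilatedTrianglePoints d w 2 := by
    rintro _ ⟨x, hx, rfl⟩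
    refine ⟨nsmul_mem hx.1 2, fun i => nsmul_nonneg (hx.2.1 i) 2, ?_⟩
    simp only [Pi.smul_apply, ← Finset.smul_sum, hx.2.2]
    norm_num
  rw [hK.vertices_eq, ← Set.ncard_image_of_injective (dilatedTrianglePoints d w 1) hinj,
    ← Set.ncard_sdiff_add_ncard_of_subset hsub hfin, ← hK.bijOn_edges.image_eq,
    hK.bijOn_edges.injOn.ncard_image]

theorem lemma1 (d : ℕ) (hd : 0 < d) (a b c : ℤ)
    (horder : orderOf (quotientGenerator d ![a, b, c]) = d)
    (hsum : (d : ℤ) ∣ a + b + c)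
    (d₁ d₂ d₃ : ℕ) (hd₁ : d₁ = Int.gcd a d) (hd₂ : d₂ = Int.gcd b d) (hd₃ : d₃ = Int.gcd c d)
    (K : Geometry.SimplicialComplex ℝ (Fin 3 → ℝ))
    (hK : IsSmoothDecomposition d ![a, b, c] K) :
    (K.vertices.ncard : ℚ) = ((d : ℚ) + 2 + (d₁ + d₂ + d₃)) / 2 ∧
      ({s ∈ K.faces | s.card = 2}.ncard : ℚ) = (3 * (d : ℚ) + (d₁ + d₂ + d₃)) / 2 := by
  have hsum' : (d : ℤ) ∣ ∑ i, ![a, b, c] i := by simpa [Fin.sum_univ_three] using hsum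
  have hfaith := dvd_of_orderOf_quotientGenerator hd horder
  have hgcd : ∑ i, (Int.gcd (![a, b, c] i) d : ℤ) = d₁ + d₂ + d₃ := by
    simp [Fin.sum_univ_three, hd₁, hd₂, hd₃]
  have h1 := two_mul_ncard_dilatedTrianglePoints_one hd hsum' hfaith
  have h2 := ncard_dilatedTrianglePoints_two hd hsum' hfaith
  rw [hgcd, ← hK.vertices_eq] at h1
  rw [hgcd, ← hK.ncard_edges_add_ncard_vertices
    (ncard_dilatedTrianglePoints hd hsum' hfaith 2).1] at h2
  rw [Nat.cast_add] at h2
  have h1' : (2 * K.vertices.ncard : ℚ) = d + 2 + (d₁ + d₂ + d₃) := by exact_mod_cast h1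
  have h2' : ({s ∈ K.faces | s.card = 2}.ncard + K.vertices.ncard : ℚ) =
      2 * d + 1 + (d₁ + d₂ + d₃) := by exact_mod_cast h2
  constructor <;> linarith
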